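/- Let $n\ge 0$ be an integer, and let $k,b,T\ge 1$ be integers with $b\mid k$; put $\ell:=k/b$ and assume $T\ge \ell$, $E:=\lfloor T/\ell\rfloor$. Let $\lambda>0$, $C\ge 0$, $\sigma>0$, $\alpha>1$ and $m,M\ge 0$ be real numbers. Let $h:\mathbb R^n\to(-\infty,\infty]$ be proper, lower semicontinuous and convex, with $\operatorname{dom}h=\{x: h(x)<\infty\}$. Let $f_1,\dots,f_k$ and $f_1',\dots,f_k'$ be real functions, each differentiable on an open set containing $\operatorname{dom}h$, such that each $g\in\{f_1,\dots,f_k,f_1',\dots,f_k'\}$ satisfies $$-\tfrac m2\|x-y\|^2\le g(x)-g(y)-\langle\nabla g(y),x-y\rangle\le \tfrac M2\|x-y\|^2\qquad\forall x,y\in\operatorname{dom}h,$$ and such that, for some index $i^*$, $f_i'=f_i$ for all $i\ne i^*$. For a proper, lower semicontinuous, convex function $\psi$ let $\operatorname{prox}_\psi(z_0)=\operatorname{argmin}_z\{\psi(z)+\tfrac12\|z-z_0\|^2\}$. Let $q_C(x)=1$ if $\|x\|\le C$ and $q_C(x)=\infty$ otherwise, and let $\operatorname{Clip}_C=\operatorname{prox}_{q_C}$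 (the projection onto the closed ball of radius $C$ about $0$). Let $X_0\in\operatorname{dom}h$ be a fixed point and let $N_1,N_2,\dots$ be independent $\mathcal N(0,\sigma^2I)$ random vectors in $\mathbb R^n$. For $t\ge1$ let $j_t=b(t-1)\bmod k$, $B_t=\{j_t+1,\dots,j_t+b\}$ and $$X_t=\operatorname{prox}_{\lambda h}\Big(X_{t-1}-\frac{\lambda}{b}\sum_{i\in B_t}\operatorname{Clip}_C(\nabla f_i(X_{t-1}))+N_t\Big),$$ and let $X_t'$ be defined in the same way from $X_0'=X_0$ and the same $N_t$, with $f_i'$ in place of $f_i$. Define $L_\lambda:=\sqrt{1+2\lambda m\left[1+\frac{m}{M+m}\right]}$ (equal to $1$ if $m=M=0$) and, for $L\geq 0$, $\theta_L(0):=0$, $\theta_L(s):=L^{2(s-1)}\big/\sum_{j=0}^{s-1}L^{2j}$ for integers $s\ge1$. For random vectors $X\sim\mu$ and $Y\sim\nu$ let $D_\alpha(X\|Y):=\frac1{\alpha-1}\log\int\big(\tfrac{d\mu}{d\nu}\big)^\alpha d\nu$ if $\mu\ll\nu$, and $D_\alpha(X\|Y):=\infty$ otherwise. If $$\lambda\le\min\Big\{\frac1{\sqrt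 E},\frac1{2(m+M)}\Big\}$$ (the second entry being read as $+\infty$ when $m=M=0$), then $X_T$ and $X_T'$ are Borel measurable functions of the noise (so their laws are well defined), and $$D_\alpha(X_T\|X_T')\le 4\alpha\Big(\frac{C}{b\sigma}\Big)^2\big[1+\theta_{L_\lambda}(\ell)\big],$$ a bound that does not depend on the number $E$ of passes. -/

import Mathlib

open MeasureTheory ProbabilityTheory

namespace DPSGD

noncomputable section

/-- Effective domain of an extended-real-valued function. -/
def dom {n : ℕ} (h : EuclideanSpace ℝ (Fin n) → EReal) : Set (EuclideanSpace ℝ (Fin n)) :=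
  {x | h x < ⊤}

/-- Proper, lower semicontinuous, convex functions with values in `(-∞, ∞]`. -/
structure IsClosedProperConvex {n : ℕ} (h : EuclideanSpace ℝ (Fin n) → EReal) : Prop where
  ne_bot : ∀ x, h x ≠ ⊥
  proper : (dom h).Nonempty
  lsc : LowerSemicontinuous h
  convex : ∀ x y : EuclideanSpace ℝ (Fin n), ∀ a b : ℝ, 0 < a → 0 < b → a + b = 1 →
    h (a • x + b • y) ≤ (a : EReal) * h x + (b : EReal) * h y

/-- The proximal operator `prox_ψ z₀ = argmin_z { ψ z + ‖z - z₀‖² / 2 }`. For proper, lower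
semicontinuous, convex `ψ` the minimizer exists and is unique. -/
def prox {n : ℕ} (ψ : EuclideanSpace ℝ (Fin n) → EReal) (z₀ : EuclideanSpace ℝ (Fin n)) :
    EuclideanSpace ℝ (Fin n) :=
  Classical.epsilon fun z => ∀ w,
    ψ z + ((‖z - z₀‖ ^ 2 / 2 : ℝ) : EReal) ≤ ψ w + ((‖w - z₀‖ ^ 2 / 2 : ℝ) : EReal)

/-- The function equal to `1` on the closed ball of radius `C` about `0` and `∞` elsewhere. -/
def qBall {n : ℕ} (C : ℝ) (x : EuclideanSpace ℝ (Fin n)) : EReal :=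
  open Classical in if ‖x‖ ≤ C then 1 else ⊤

/-- Norm clipping at level `C`, as the proximal operator of `qBall C`. -/
def clip {n : ℕ} (C : ℝ) (y : EuclideanSpace ℝ (Fin n)) : EuclideanSpace ℝ (Fin n) :=
  prox (qBall C) y

/-- Each `f i` is differentiable on an open set containing `dom h` and has lower curvature `-m`
and upper curvature `M` on `dom h`. -/
def CurvatureBounds {n k : ℕ} (m M : ℝ) (h : EuclideanSpace ℝ (Fin n) → EReal)
    (f : Fin k → EuclideanSpace ℝ (Fin n) → ℝ) : Prop :=
  ∀ i, (∃ U : Set (EuclideanSpace ℝ (Fin n)), IsOpen U ∧ dom h ⊆ U ∧ DifferentiableOn ℝ (f i) U) ∧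
    ∀ x ∈ dom h, ∀ y ∈ dom h,
      -(m / 2) * ‖x - y‖ ^ 2 ≤ f i x - f i y - inner ℝ (gradient (f i) y) (x - y) ∧
      f i x - f i y - inner ℝ (gradient (f i) y) (x - y) ≤ M / 2 * ‖x - y‖ ^ 2

/-- The cyclic batch of step `t ≥ 1`: with `j_t = b (t - 1) mod k`, the indices
`j_t + 1, …, j_t + b` of `{1, …, k}`. The element `i` of `Fin k` stands for the index `i + 1`. -/
def batch (k b t : ℕ) : Finset (Fin k) :=
  Finset.univ.filter fun i =>
    (i : ℕ) + 1 ∈ Finset.Icc (b * (t - 1) % k + 1) (b * (t - 1) % k + b)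

/-- The average of the clipped gradients over the batch of step `t`. -/
def batchGrad {n k : ℕ} (C : ℝ) (b : ℕ) (f : Fin k → EuclideanSpace ℝ (Fin n) → ℝ) (t : ℕ)
    (x : EuclideanSpace ℝ (Fin n)) : EuclideanSpace ℝ (Fin n) :=
  (1 / (b : ℝ)) • ∑ i ∈ batch k b t, clip C (gradient (f i) x)

/-- The iterates `X_t` of cyclically sampled DP-SGD started at `x₀`, driven by the noise
sequence `noise 1, noise 2, …`:
`X_t = prox_{lam h} (X_{t-1} - lam g_t + N_t)`. -/
def iterate {n k : ℕ} (lam C : ℝ) (b : ℕ) (h : EuclideanSpace ℝ (Fin n) → EReal)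
    (f : Fin k → EuclideanSpace ℝ (Fin n) → ℝ) (x₀ : EuclideanSpace ℝ (Fin n))
    (noise : ℕ → EuclideanSpace ℝ (Fin n)) : ℕ → EuclideanSpace ℝ (Fin n)
  | 0 => x₀
  | t + 1 =>
    prox (fun x => (lam : EReal) * h x)
      (iterate lam C b h f x₀ noise t
        - lam • batchGrad C b f (t + 1) (iterate lam C b h f x₀ noise t) + noise (t + 1))

/-- The isotropic Gaussian law `N(0, σ² I)`. -/
def isoGaussian (n : ℕ) (σ : ℝ) : Measure (EuclideanSpace ℝ (Fin n)) :=
  (stdGaussian (EuclideanSpace ℝ (Fin n))).map fun x => σ • x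

/-- The Rényi divergence `D_α(μ‖ν) = (α - 1)⁻¹ log ∫ (dμ/dν)^α dν` of order `α ∈ (1, ∞)` between
probability measures, equal to `∞` when `μ` is not absolutely continuous with respect to `ν`. -/
def renyiDiv {X : Type*} [MeasurableSpace X] (α : ℝ) (μ ν : Measure X) : EReal :=
  open Classical in
  if μ ≪ ν then (((α - 1)⁻¹ : ℝ) : EReal) * ENNReal.log (∫⁻ x, μ.rnDeriv ν x ^ α ∂ν) else ⊤

/-- `θ_L(0) = 0` and `θ_L(s) = L^{2(s-1)} / ∑_{j=0}^{s-1} L^{2j}` for `s ≥ 1`. -/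
def theta (L : ℝ) (s : ℕ) : ℝ :=
  if s = 0 then 0 else L ^ (2 * (s - 1)) / ∑ j ∈ Finset.range s, L ^ (2 * j)

/-- `L_lam(m, M) = √(1 + 2 lam m [1 + m / (M + m)])`; for `m = M = 0` it equals `1`. -/
def lipConst (lam m M : ℝ) : ℝ :=
  Real.sqrt (1 + 2 * lam * m * (1 + m / (M + m)))

end

end DPSGD

open scoped ENNReal

namespace DPSGD

/-! ### Proximal maps: existence and nonexpansiveness -/

section Prox

variable {n : ℕ} {ψ : EuclideanSpace ℝ (Fin n) → EReal}

/-! One step is a Gaussian mechanism followed by a fixed measurable map, the proximal operator. From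
a common point, the drifts of the two runs differ by at most `lam * (2 * C / b)` when the batch
contains `i₀`, because clipping bounds both versions of the single summand that changes, and they
agree otherwise. A visit to `i₀` therefore costs Rényi divergence at most `α * (lam * (2 * C / b)) ^
2 / (2 * σ ^ 2)`, and adaptive composition adds these costs.

Cyclic sampling visits `i₀` at most `E + 1 ≤ 2 * E` times, and the stepsize gives `lam ^ 2 * E ≤ 1`,
so the number of passes cancels: the total is at most `4 * α * (C / (b * σ)) ^ 2`. The `theta` term
is nonnegative and only enlarges the bound.

Composition (`holderBound_iterate`) is carried out in the dual form `HolderBound`, whose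
inequalities can be nested step by step without handling densities of the iterates.
`lintegral_isoGaussian_shift_le` supplies one step, and `HolderBound.renyiDiv_le` converts the
result back to a divergence. -/

theorem IsClosedProperConvex.exists_coe (hψ : IsClosedProperConvex ψ)
    {x : EuclideanSpace ℝ (Fin n)} (hx : x ∈ dom ψ) : ∃ r : ℝ, ψ x = r :=
  ⟨(ψ x).toReal, (EReal.coe_toReal (ne_of_lt hx) (hψ.ne_bot x)).symm⟩

/-- A proper, lower semicontinuous, convex function decreases at most linearly. -/
theorem IsClosedProperConvex.exists_lower_bound (hψ : IsClosedProperConvex ψ)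
    {x₀ : EuclideanSpace ℝ (Fin n)} {r₀ : ℝ} (hx₀ : ψ x₀ = r₀) :
    ∃ A : ℝ, 0 ≤ A ∧ ∀ x, ((r₀ - A * max 1 ‖x - x₀‖ : ℝ) : EReal) ≤ ψ x := by
  obtain ⟨y, hy, hmin⟩ := (hψ.lsc.lowerSemicontinuousOn
    (Metric.closedBall x₀ 1)).exists_isMinOn ⟨x₀, by simp⟩ (isCompact_closedBall x₀ 1)
  have hyx₀ : ψ y ≤ ψ x₀ := hmin (by simp)
  obtain ⟨β, hβ⟩ := hψ.exists_coe (x := y)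
    (show ψ y < ⊤ from hyx₀.trans_lt (by rw [hx₀]; exact EReal.coe_lt_top _))
  rw [hβ, hx₀, EReal.coe_le_coe_iff] at hyx₀
  refine ⟨r₀ - β, by linarith, fun x => ?_⟩
  rcases le_or_gt ‖x - x₀‖ 1 with hr | hr
  · rw [max_eq_left hr, mul_one, sub_sub_cancel, ← hβ]
    exact hmin (by simpa [dist_eq_norm] using hr)
  · rw [max_eq_right hr.le]
    set r := ‖x - x₀‖
    have hr0 : 0 < r := by linarith
    by_cases hx : ψ x = ⊤
    · rw [hx]; exact le_top
    obtain ⟨s, hs⟩ := hψ.exists_coe (x := x) (lt_top_iff_ne_top.2 hx)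
    -- The segment from `x₀` to `x` leaves the unit ball here; convexity carries the bound `β` on
    -- the ball out to `x`.
    have hz : r⁻¹ • x + (1 - r⁻¹) • x₀ ∈ Metric.closedBall x₀ 1 := by
      rw [mem_closedBall_iff_norm]
      have : r⁻¹ • x + (1 - r⁻¹) • x₀ - x₀ = r⁻¹ • (x - x₀) := by module
      rw [this, norm_smul, norm_inv, Real.norm_of_nonneg hr0.le]
      exact (inv_mul_cancel₀ hr0.ne').le
    have h1 : ψ y ≤ ψ (r⁻¹ • x + (1 - r⁻¹) • x₀) := hmin hz
    have h2 := h1.trans (hψ.convex x x₀ r⁻¹ (1 - r⁻¹) (by positivity)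
      (by have := inv_lt_one_of_one_lt₀ hr; linarith) (by ring))
    rw [hβ, hs, hx₀] at h2
    norm_cast at h2
    rw [hs, EReal.coe_le_coe_iff]
    have h3 := mul_le_mul_of_nonneg_left h2 hr0.le
    have h4 : r * (r⁻¹ * s + (1 - r⁻¹) * r₀) = s + (r - 1) * r₀ := by field_simp
    rw [h4] at h3
    linarith

theorem IsClosedProperConvex.exists_prox (hψ : IsClosedProperConvex ψ)
    (z₀ : EuclideanSpace ℝ (Fin n)) :
    ∃ z, ∀ w, ψ z + ((‖z - z₀‖ ^ 2 / 2 : ℝ) : EReal) ≤ ψ w + ((‖w - z₀‖ ^ 2 / 2 : ℝ) : EReal) := by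
  obtain ⟨x₀, hx₀⟩ := hψ.proper
  obtain ⟨r₀, hr₀⟩ := hψ.exists_coe hx₀
  obtain ⟨A, hA, hlow⟩ := hψ.exists_lower_bound hr₀
  set d := ‖x₀ - z₀‖ with hd
  have hd0 : 0 ≤ d := norm_nonneg _
  have hlsc : LowerSemicontinuous fun w => ψ w + ((‖w - z₀‖ ^ 2 / 2 : ℝ) : EReal) := by
    refine hψ.lsc.add' (continuous_coe_real_ereal.comp (by fun_prop :
      Continuous fun w => ‖w - z₀‖ ^ 2 / 2)).lowerSemicontinuous fun x => ?_
    exact EReal.continuousAt_add (Or.inr (EReal.coe_ne_bot _)) (Or.inr (EReal.coe_ne_top _))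
  -- With `R = ‖w - x₀‖ ≥ 1`, the objective at `w` is at least `r₀ - A * R + (R - d) ^ 2 / 2`, which
  -- exceeds its value at `x₀` once `R ≥ 2 * (d + A)`. The extra `1` in the radius ensures `R ≥ 1`.
  obtain ⟨z, -, hmin⟩ := (hlsc.lowerSemicontinuousOn
    (Metric.closedBall x₀ (2 * (d + A) + 1))).exists_isMinOn
    ⟨x₀, Metric.mem_closedBall_self (by positivity)⟩ (isCompact_closedBall x₀ _)
  refine ⟨z, fun w => ?_⟩
  by_cases hw : w ∈ Metric.closedBall x₀ (2 * (d + A) + 1)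
  · exact hmin hw
  refine (hmin (Metric.mem_closedBall_self (by positivity)) : _ ≤ _).trans ?_
  rw [mem_closedBall_iff_norm, not_le] at hw
  have h1 := add_le_add_left (hlow w) ((‖w - z₀‖ ^ 2 / 2 : ℝ) : EReal)
  refine le_trans ?_ h1
  beta_reduce
  rw [hr₀, max_eq_right (by linarith), ← hd]
  norm_cast
  have h2 : ‖w - x₀‖ - d ≤ ‖w - z₀‖ := by
    have := norm_sub_le (w - z₀) (x₀ - z₀)
    rw [sub_sub_sub_cancel_right] at this
    linarith
  have h3 : (‖w - x₀‖ - d) ^ 2 ≤ ‖w - z₀‖ ^ 2 := pow_le_pow_left₀ (by linarith) h2 2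
  nlinarith

theorem IsClosedProperConvex.prox_spec (hψ : IsClosedProperConvex ψ)
    (z₀ w : EuclideanSpace ℝ (Fin n)) :
    ψ (prox ψ z₀) + ((‖prox ψ z₀ - z₀‖ ^ 2 / 2 : ℝ) : EReal) ≤
      ψ w + ((‖w - z₀‖ ^ 2 / 2 : ℝ) : EReal) :=
  Classical.epsilon_spec (hψ.exists_prox z₀) w

theorem IsClosedProperConvex.prox_mem_dom (hψ : IsClosedProperConvex ψ)
    (z₀ : EuclideanSpace ℝ (Fin n)) : prox ψ z₀ ∈ dom ψ := by
  obtain ⟨x₀, hx₀⟩ := hψ.proper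
  obtain ⟨r₀, hr₀⟩ := hψ.exists_coe hx₀
  have h := hψ.prox_spec z₀ x₀
  rw [hr₀, ← EReal.coe_add] at h
  refine (lt_top_iff_ne_top.2 fun htop => ?_ : ψ _ < ⊤)
  rw [htop, EReal.top_add_coe] at h
  exact absurd h (not_le.2 (EReal.coe_lt_top _))

/-- The variational inequality characterizing the proximal point. -/
theorem IsClosedProperConvex.prox_variational (hψ : IsClosedProperConvex ψ)
    {z₀ w : EuclideanSpace ℝ (Fin n)} {s s' : ℝ} (hs : ψ (prox ψ z₀) = s) (hs' : ψ w = s') :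
    s ≤ s' + inner ℝ (prox ψ z₀ - z₀) (w - prox ψ z₀) := by
  set p := prox ψ z₀ with hp
  have key : ∀ t : ℝ, 0 < t → t < 1 →
      s - s' - inner ℝ (p - z₀) (w - p) ≤ t * (‖w - p‖ ^ 2 / 2) := by
    intro t ht ht1
    have h1 := hψ.prox_spec z₀ ((1 - t) • p + t • w)
    have h2 := hψ.convex p w (1 - t) t (by linarith) ht (by ring)
    have h3 := h1.trans (add_le_add_left h2 _)
    rw [← hp, hs, hs'] at h3
    norm_cast at h3
    have h4 : (1 - t) • p + t • w - z₀ = (p - z₀) + t • (w - p) := by module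
    rw [h4, norm_add_sq_real, inner_smul_right, norm_smul, mul_pow, Real.norm_eq_abs, sq_abs] at h3
    refine le_of_mul_le_mul_left ?_ ht
    linarith
  by_contra! hlt
  set g := s - s' - inner ℝ (p - z₀) (w - p) with hg
  have hg0 : 0 < g := by linarith
  set D := ‖w - p‖ ^ 2 with hD
  have hD0 : 0 ≤ D := sq_nonneg _
  -- This `t` lies in `(0, 1)`, and `g ≤ t * D / 2` would force `D + 2 * g ≤ D / 2`.
  have h := key (g / (D + 2 * g)) (by positivity) (by rw [div_lt_one (by positivity)]; linarith)
  rw [div_mul_eq_mul_div, le_div_iff₀ (by positivity)] at h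
  nlinarith [mul_pos hg0 hg0, mul_nonneg hg0.le hD0]

/-- Adding the variational inequalities at the two points gives `‖p - q‖ ^ 2 ≤ ⟪z - w, p - q⟫`;
Cauchy–Schwarz concludes. Its use is to make `prox` and `clip` measurable. -/
theorem IsClosedProperConvex.lipschitzWith_prox (hψ : IsClosedProperConvex ψ) :
    LipschitzWith 1 (prox ψ) := by
  refine LipschitzWith.of_dist_le_mul fun z w => ?_
  obtain ⟨s, hs⟩ := hψ.exists_coe (hψ.prox_mem_dom z)
  obtain ⟨s', hs'⟩ := hψ.exists_coe (hψ.prox_mem_dom w)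
  have h1 := hψ.prox_variational hs hs'
  have h2 := hψ.prox_variational hs' hs
  rw [dist_eq_norm, dist_eq_norm, NNReal.coe_one, one_mul]
  set p := prox ψ z
  set q := prox ψ w
  have h3 : inner ℝ (p - z) (q - p) + inner ℝ (q - w) (p - q) =
      inner ℝ (z - w) (p - q) - ‖p - q‖ ^ 2 := by
    rw [← real_inner_self_eq_norm_sq, ← neg_sub p q, inner_neg_right, ← sub_eq_neg_add,
      ← inner_sub_left, ← inner_sub_left]
    congr 1
    abel
  have h4 := real_inner_le_norm (z - w) (p - q)
  rcases (norm_nonneg (p - q)).eq_or_lt with h0 | h0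
  · rw [← h0]; exact norm_nonneg _
  · refine le_of_mul_le_mul_right ?_ h0
    nlinarith

theorem IsClosedProperConvex.const_mul (hψ : IsClosedProperConvex ψ) {c : ℝ} (hc : 0 < c) :
    IsClosedProperConvex fun x => (c : EReal) * ψ x where
  ne_bot x := by
    rcases eq_or_ne (ψ x) ⊤ with hx | hx
    · simp [hx, EReal.coe_mul_top_of_pos hc]
    · obtain ⟨s, hs⟩ := hψ.exists_coe (x := x) (lt_top_iff_ne_top.2 hx)
      rw [hs, ← EReal.coe_mul]
      exact EReal.coe_ne_bot _
  proper := by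
    obtain ⟨x, hx⟩ := hψ.proper
    obtain ⟨s, hs⟩ := hψ.exists_coe hx
    refine ⟨x, ?_⟩
    change (c : EReal) * ψ x < ⊤
    rw [hs, ← EReal.coe_mul]
    exact EReal.coe_lt_top _
  lsc := have hc0 : (c : EReal) ≠ 0 := by exact_mod_cast hc.ne'
    Continuous.comp_lowerSemicontinuous (g := fun y : EReal => (c : EReal) * y)
    (continuous_iff_continuousAt.2 fun y =>
      (EReal.continuousAt_mul (p := ((c : EReal), y)) (Or.inl hc0)
        (Or.inl hc0) (Or.inl (EReal.coe_ne_bot c))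
        (Or.inl (EReal.coe_ne_top c))).comp (by fun_prop)) hψ.lsc
    (fun _ _ h => mul_le_mul_of_nonneg_left h (by exact_mod_cast hc.le))
  convex x y a b ha hb hab := by
    refine (mul_le_mul_of_nonneg_left (hψ.convex x y a b ha hb hab)
      (by exact_mod_cast hc.le)).trans_eq ?_
    rw [EReal.left_distrib_of_nonneg_of_ne_top (by exact_mod_cast hc.le) (EReal.coe_ne_top c),
      mul_left_comm, mul_left_comm (c : EReal) (b : EReal)]

end Prox

/-! ### Clipping as a projection -/

section Clip

variable {n : ℕ} {C : ℝ}

theorem isClosedProperConvex_qBall (hC : 0 ≤ C) :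
    IsClosedProperConvex (qBall (n := n) C) where
  ne_bot x := by
    unfold qBall
    split_ifs
    exacts [EReal.coe_ne_bot 1, bot_ne_top.symm]
  proper := ⟨0, by simpa [dom, qBall, hC] using EReal.coe_lt_top 1⟩
  lsc := by
    intro x a ha
    by_cases hx : ‖x‖ ≤ C
    · refine Filter.Eventually.of_forall fun y => ha.trans_le ?_
      unfold qBall
      rw [if_pos hx]
      split_ifs
      exacts [le_rfl, le_top]
    · have : ∀ᶠ y in nhds x, C < ‖y‖ :=
        continuous_norm.continuousAt.eventually (lt_mem_nhds (not_le.1 hx))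
      filter_upwards [this] with y hy
      unfold qBall at ha ⊢
      rw [if_neg hx] at ha
      rwa [if_neg (not_le.2 hy)]
  convex x y a b ha hb hab := by
    unfold qBall
    by_cases hx : ‖x‖ ≤ C
    · by_cases hy : ‖y‖ ≤ C
      · have : ‖a • x + b • y‖ ≤ C := by
          have := (convex_closedBall (0 : EuclideanSpace ℝ (Fin n)) C)
            (by simpa using hx : x ∈ _) (by simpa using hy : y ∈ _) ha.le hb.le hab
          simpa using this
        rw [if_pos hx, if_pos hy, if_pos this, mul_one, mul_one]
        exact_mod_cast hab.ge
      · rw [if_pos hx, if_neg hy, EReal.coe_mul_top_of_pos hb, mul_one, EReal.coe_add_top]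
        exact le_top
    · rw [if_neg hx, EReal.coe_mul_top_of_pos ha]
      refine le_top.trans_eq (EReal.top_add_of_ne_bot ?_).symm
      split_ifs
      · simp
      · simp [EReal.coe_mul_top_of_pos hb]

theorem norm_clip_le (hC : 0 ≤ C) (y : EuclideanSpace ℝ (Fin n)) : ‖clip C y‖ ≤ C := by
  have h := (isClosedProperConvex_qBall (n := n) hC).prox_mem_dom y
  by_contra hlt
  change qBall C (clip C y) < ⊤ at h
  simp [qBall, hlt] at h

theorem measurable_clip (hC : 0 ≤ C) : Measurable (clip (n := n) C) :=
  (isClosedProperConvex_qBall hC).lipschitzWith_prox.continuous.measurable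

end Clip

/-! ### Change of measure for shifted Gaussians -/

section GaussianShift

variable {n : ℕ}

theorem lintegral_pi_prod {ι X : Type*} [Fintype ι] [MeasurableSpace X] (μ : ι → Measure X)
    [∀ i, IsProbabilityMeasure (μ i)] {g : ι → X → ℝ≥0∞} (hg : ∀ i, Measurable (g i)) :
    ∫⁻ x, ∏ i, g i (x i) ∂Measure.pi μ = ∏ i, ∫⁻ x, g i x ∂μ i := by
  rw [lintegral_prod_eq_prod_lintegral_of_indepFun Finset.univ _
    (iIndepFun_pi fun i => (hg i).aemeasurable) fun i => (hg i).comp (measurable_pi_apply i)]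
  refine Finset.prod_congr rfl fun i _ => ?_
  rw [← (measurePreserving_eval μ i).map_eq, lintegral_map (hg i) (measurable_pi_apply i)]

theorem pi_withDensity {ι X : Type*} [Fintype ι] [MeasurableSpace X] (μ : ι → Measure X)
    [∀ i, IsProbabilityMeasure (μ i)] {g : ι → X → ℝ≥0∞} (hg : ∀ i, Measurable (g i))
    [∀ i, SigmaFinite ((μ i).withDensity (g i))] :
    Measure.pi (fun i => (μ i).withDensity (g i)) =
      (Measure.pi μ).withDensity fun x => ∏ i, g i (x i) := by
  refine Measure.pi_eq fun s hs => ?_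
  rw [withDensity_apply _ (MeasurableSet.univ_pi hs), ← lintegral_indicator (MeasurableSet.univ_pi hs)]
  have : ∀ x : ι → X, (Set.univ.pi s).indicator (fun x => ∏ i, g i (x i)) x =
      ∏ i, (s i).indicator (g i) (x i) := by
    intro x
    by_cases hx : x ∈ Set.univ.pi s
    · rw [Set.indicator_of_mem hx]
      exact Finset.prod_congr rfl fun i _ => (Set.indicator_of_mem (hx i trivial) _).symm
    · rw [Set.indicator_of_notMem hx]
      simp only [Set.mem_pi, Set.mem_univ, true_imp_iff, not_forall] at hx
      obtain ⟨i, hi⟩ := hx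
      exact (Finset.prod_eq_zero (Finset.mem_univ i) (Set.indicator_of_notMem hi _)).symm
  simp_rw [this]
  rw [lintegral_pi_prod μ fun i => (hg i).indicator (hs i)]
  exact Finset.prod_congr rfl fun i _ => by
    rw [lintegral_indicator (hs i), withDensity_apply _ (hs i)]

theorem gaussianReal_eq_withDensity (u : ℝ) :
    gaussianReal u 1 =
      (gaussianReal 0 1).withDensity fun x => ENNReal.ofReal (Real.exp (u * x - u ^ 2 / 2)) := by
  rw [gaussianReal_of_var_ne_zero u one_ne_zero, gaussianReal_of_var_ne_zero 0 one_ne_zero,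
    ← withDensity_mul _ (measurable_gaussianPDF 0 1) (by fun_prop)]
  congr 1
  ext x
  rw [Pi.mul_apply, gaussianPDF, gaussianPDF, ← ENNReal.ofReal_mul (gaussianPDFReal_nonneg _ _ _),
    gaussianPDFReal, gaussianPDFReal, mul_assoc _ (Real.exp _) (Real.exp _), ← Real.exp_add]
  congr 3
  simp only [NNReal.coe_one]
  ring

theorem lintegral_exp_gaussianReal (a c : ℝ) :
    ∫⁻ x, ENNReal.ofReal (Real.exp (a * x + c)) ∂gaussianReal 0 1 =
      ENNReal.ofReal (Real.exp (a ^ 2 / 2 + c)) := by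
  rw [← ofReal_integral_eq_lintegral_ofReal]
  · have h := congrFun (mgf_id_gaussianReal (μ := 0) (v := 1)) a
    simp only [mgf, id] at h
    simp_rw [Real.exp_add, integral_mul_const, h]
    simp
  · simp_rw [Real.exp_add]
    exact (integrable_exp_mul_gaussianReal a).mul_const _
  · exact Filter.Eventually.of_forall fun x => (Real.exp_pos _).le

/-- Hölder form of the Rényi divergence between shifts of a standard Gaussian. -/
theorem lintegral_pi_gaussianReal_add_le {ι : Type*} [Fintype ι] {p q : ℝ}
    (hpq : p.HolderConjugate q) (u : ι → ℝ) {ψ : (ι → ℝ) → ℝ≥0∞} (hψ : Measurable ψ) :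
    ∫⁻ x, ψ (x + u) ∂Measure.pi (fun _ : ι => gaussianReal 0 1) ≤
      ENNReal.ofReal (Real.exp ((p - 1) * (∑ i, u i ^ 2) / 2)) *
        (∫⁻ x, ψ x ^ q ∂Measure.pi (fun _ : ι => gaussianReal 0 1)) ^ (1 / q) := by
  -- Cameron–Martin: the shifted Gaussian has density `exp (⟪u, x⟫ - ‖u‖ ^ 2 / 2)`. Hölder then
  -- leaves only the `L^p` norm of this density to compute.
  have hshift : (Measure.pi fun _ : ι => gaussianReal 0 1).map (fun x => x + u) =
      (Measure.pi fun _ : ι => gaussianReal 0 1).withDensity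
        fun x => ∏ i, ENNReal.ofReal (Real.exp (u i * x i - u i ^ 2 / 2)) := by
    have : ∀ i, SigmaFinite ((gaussianReal 0 1).withDensity
        fun x => ENNReal.ofReal (Real.exp (u i * x - u i ^ 2 / 2))) := fun i => by
      rw [← gaussianReal_eq_withDensity]; infer_instance
    rw [← pi_withDensity (fun _ : ι => gaussianReal 0 1)
      (g := fun i x => ENNReal.ofReal (Real.exp (u i * x - u i ^ 2 / 2))) (fun i => by fun_prop)]
    have h1 : ∀ i, IsProbabilityMeasure ((gaussianReal 0 1).map (· + u i)) := fun i =>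
      Measure.isProbabilityMeasure_map (by fun_prop)
    rw [show (fun x : ι → ℝ => x + u) = fun x i => (fun y => y + u i) (x i) from rfl,
      Measure.pi_map_pi (μ := fun _ : ι => gaussianReal 0 1) (f := fun i y => y + u i)
        (fun i => by fun_prop)]
    congr 1
    ext1 i
    rw [gaussianReal_map_add_const, zero_add, gaussianReal_eq_withDensity]
  have hw : Measurable fun x : ι → ℝ =>
      ∏ i, ENNReal.ofReal (Real.exp (u i * x i - u i ^ 2 / 2)) := by fun_prop
  rw [← lintegral_map hψ (by fun_prop : Measurable fun x : ι → ℝ => x + u), hshift,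
    lintegral_withDensity_eq_lintegral_mul _ hw hψ]
  refine (ENNReal.lintegral_mul_le_Lp_mul_Lq _ hpq hw.aemeasurable hψ.aemeasurable).trans_eq ?_
  congr 1
  have hpow : ∀ x : ι → ℝ, (∏ i, ENNReal.ofReal (Real.exp (u i * x i - u i ^ 2 / 2))) ^ p =
      ∏ i, ENNReal.ofReal (Real.exp (p * u i * x i + -(p * u i ^ 2 / 2))) := by
    intro x
    rw [← ENNReal.prod_rpow_of_nonneg hpq.nonneg]
    refine Finset.prod_congr rfl fun i _ => ?_
    rw [ENNReal.ofReal_rpow_of_pos (Real.exp_pos _), ← Real.exp_mul]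
    congr 2
    ring
  simp_rw [hpow]
  rw [lintegral_pi_prod (fun _ : ι => gaussianReal 0 1)
    (g := fun i x => ENNReal.ofReal (Real.exp (p * u i * x + -(p * u i ^ 2 / 2))))
    (fun i => by fun_prop)]
  simp_rw [lintegral_exp_gaussianReal]
  rw [← ENNReal.ofReal_prod_of_nonneg (fun i _ => (Real.exp_pos _).le), ← Real.exp_sum,
    ENNReal.ofReal_rpow_of_pos (Real.exp_pos _), ← Real.exp_mul]
  congr 2
  have hp := hpq.ne_zero
  have : ∀ i, (p * u i) ^ 2 / 2 + -(p * u i ^ 2 / 2) = p * ((p - 1) / 2) * u i ^ 2 := fun i => by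
    ring
  simp_rw [this]
  rw [← Finset.mul_sum]
  field_simp

theorem lintegral_isoGaussian {σ : ℝ} {φ : EuclideanSpace ℝ (Fin n) → ℝ≥0∞} (hφ : Measurable φ) :
    ∫⁻ z, φ z ∂isoGaussian n σ =
      ∫⁻ x, φ (σ • WithLp.toLp 2 x) ∂Measure.pi (fun _ : Fin n => gaussianReal 0 1) := by
  rw [isoGaussian, lintegral_map hφ (by fun_prop), ← map_pi_eq_stdGaussian,
    lintegral_map (by fun_prop) (by fun_prop)]

theorem lintegral_isoGaussian_shift_le {σ : ℝ} (hσ : 0 < σ) {p q : ℝ} (hpq : p.HolderConjugate q)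
    (a a' : EuclideanSpace ℝ (Fin n)) {r : ℝ} (hr : ‖a - a'‖ ≤ r)
    {φ : EuclideanSpace ℝ (Fin n) → ℝ≥0∞} (hφ : Measurable φ) :
    ∫⁻ z, φ (a + z) ∂isoGaussian n σ ≤
      ENNReal.ofReal (Real.exp ((p - 1) * r ^ 2 / (2 * σ ^ 2))) *
        (∫⁻ z, φ (a' + z) ^ q ∂isoGaussian n σ) ^ (1 / q) := by
  rw [lintegral_isoGaussian (by fun_prop), lintegral_isoGaussian (by fun_prop)]
  set u : Fin n → ℝ := fun i => (a i - a' i) / σ with hu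
  have h1 : ∀ x : Fin n → ℝ, φ (a + σ • WithLp.toLp 2 x) =
      (fun y : Fin n → ℝ => φ (a' + σ • WithLp.toLp 2 y)) (x + u) := by
    intro x
    beta_reduce
    congr 1
    ext i
    simp only [PiLp.add_apply, PiLp.smul_apply, Pi.add_apply, smul_eq_mul, hu]
    field_simp
    ring
  simp_rw [h1]
  refine (lintegral_pi_gaussianReal_add_le hpq u
    (ψ := fun y : Fin n → ℝ => φ (a' + σ • WithLp.toLp 2 y)) (by fun_prop)).trans ?_
  gcongr ENNReal.ofReal (Real.exp ?_) * _
  have h2 : ∑ i, u i ^ 2 = ‖a - a'‖ ^ 2 / σ ^ 2 := by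
    simp_rw [hu, div_pow]
    rw [← Finset.sum_div, EuclideanSpace.real_norm_sq_eq]
    rfl
  have h3 : ‖a - a'‖ ^ 2 ≤ r ^ 2 := pow_le_pow_left₀ (norm_nonneg _) hr 2
  have hp : 0 ≤ p - 1 := by linarith [hpq.lt]
  rw [h2, mul_div_assoc, div_div, mul_comm (σ ^ 2), mul_div_assoc]
  gcongr

end GaussianShift

/-! ### Duality between Hölder bounds and Rényi divergence -/

section HolderBound

variable {X : Type*} [MeasurableSpace X]

/-- The dual form of the bound `‖dμ/dν‖_p ≤ c` in `L^p(ν)`, with `q` the exponent conjugate to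
`p`. -/
def HolderBound (q : ℝ) (c : ℝ≥0∞) (μ ν : Measure X) : Prop :=
  ∀ φ : X → ℝ≥0∞, Measurable φ → ∫⁻ x, φ x ∂μ ≤ c * (∫⁻ x, φ x ^ q ∂ν) ^ (1 / q)

theorem HolderBound.absolutelyContinuous {q : ℝ} {c : ℝ≥0∞} {μ ν : Measure X} (hq : 0 < q)
    (h : HolderBound q c μ ν) : μ ≪ ν := by
  refine Measure.AbsolutelyContinuous.mk fun s hs hν => ?_
  have h1 := h (s.indicator 1) (measurable_one.indicator hs)
  have h2 : ∀ x, s.indicator (1 : X → ℝ≥0∞) x ^ q = s.indicator 1 x := fun x => by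
    by_cases hx : x ∈ s <;> simp [hx, hq]
  simp_rw [h2] at h1
  rw [lintegral_indicator_one hs, lintegral_indicator_one hs, hν,
    ENNReal.zero_rpow_of_pos (by positivity), mul_zero] at h1
  exact le_antisymm h1 zero_le

/-- Converse of Hölder: testing against `g ^ (p - 1)` gives `I ≤ c * I ^ (1 / q)` for `I = ∫ g ^ p`.
Truncating `g` at `k` makes `I` finite, so that division is legitimate; monotone convergence removes
the truncation. -/
theorem HolderBound.lintegral_rnDeriv_rpow_le {p q : ℝ} (hpq : p.HolderConjugate q) {c : ℝ≥0∞}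
    {μ ν : Measure X} [IsFiniteMeasure μ] [IsFiniteMeasure ν] (h : HolderBound q c μ ν) :
    ∫⁻ x, μ.rnDeriv ν x ^ p ∂ν ≤ c ^ p := by
  have hp0 : 0 < p := hpq.pos
  have hq0 : 0 < q := hpq.symm.pos
  have hac := h.absolutelyContinuous hq0
  set g := μ.rnDeriv ν with hg
  have hgm : Measurable g := Measure.measurable_rnDeriv μ ν
  have htrunc : ∀ k : ℕ, ∫⁻ x, min (g x) k ^ p ∂ν ≤ c ^ p := by
    intro k
    set I := ∫⁻ x, min (g x) k ^ p ∂ν with hI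
    have hItop : I ≠ ⊤ := by
      refine ne_top_of_le_ne_top (b := ∫⁻ _, (k : ℝ≥0∞) ^ p ∂ν) ?_
        (lintegral_mono fun x => ENNReal.rpow_le_rpow (min_le_right _ _) hp0.le)
      rw [lintegral_const]
      exact ENNReal.mul_ne_top (ENNReal.rpow_ne_top_of_nonneg hp0.le (by simp))
        (measure_ne_top ν _)
    have hm : Measurable fun x => min (g x) (k : ℝ≥0∞) ^ (p - 1) :=
      (hgm.min measurable_const).pow_const _
    have h1 := h _ hm
    have h2 : ∀ x, (min (g x) (k : ℝ≥0∞) ^ (p - 1)) ^ q = min (g x) (k : ℝ≥0∞) ^ p := fun x => by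
      rw [← ENNReal.rpow_mul, hpq.sub_one_mul_conj]
    simp_rw [h2] at h1
    rw [← Measure.withDensity_rnDeriv_eq μ ν hac,
      lintegral_withDensity_eq_lintegral_mul _ hgm hm] at h1
    have h3 : I ≤ c * I ^ (1 / q) := by
      refine le_trans (lintegral_mono fun x => ?_) h1
      rw [Pi.mul_apply]
      calc min (g x) (k : ℝ≥0∞) ^ p = min (g x) (k : ℝ≥0∞) ^ (1 : ℝ) *
            min (g x) (k : ℝ≥0∞) ^ (p - 1) := by
            rw [← ENNReal.rpow_add_of_nonneg _ _ zero_le_one (by linarith [hpq.lt])]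
            congr 1
            ring
        _ ≤ g x * min (g x) (k : ℝ≥0∞) ^ (p - 1) := by
            rw [ENNReal.rpow_one]
            gcongr
            exact min_le_left _ _
    rcases eq_or_ne I 0 with h0 | h0
    · rw [h0]; exact zero_le
    have h4 : I = I ^ (1 / p) * I ^ (1 / q) := by
      rw [← ENNReal.rpow_add _ _ h0 hItop, one_div, one_div, hpq.inv_add_inv_eq_one,
        ENNReal.rpow_one]
    have h5 : I ^ (1 / p) ≤ c := by
      have hne : I ^ (1 / q) ≠ 0 := by simp [h0, hItop]
      have hnt : I ^ (1 / q) ≠ ⊤ := ENNReal.rpow_ne_top_of_nonneg (by positivity) hItop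
      exact (ENNReal.mul_le_mul_iff_left hne hnt).1 (h4.symm.trans_le h3)
    calc I = (I ^ (1 / p)) ^ p := by
          rw [← ENNReal.rpow_mul, one_div, inv_mul_cancel₀ hp0.ne', ENNReal.rpow_one]
      _ ≤ c ^ p := ENNReal.rpow_le_rpow h5 hp0.le
  have hsup : ∀ x, g x ^ p = ⨆ k : ℕ, min (g x) (k : ℝ≥0∞) ^ p := by
    intro x
    have h1 : g x = ⨆ k : ℕ, min (g x) (k : ℝ≥0∞) := by
      rw [← inf_iSup_eq, ENNReal.iSup_natCast, inf_top_eq]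
    conv_lhs => rw [h1]
    exact (ENNReal.orderIsoRpow p hp0).map_iSup _
  simp_rw [hsup]
  rw [lintegral_iSup (fun k => (hgm.min measurable_const).pow_const _)]
  · exact iSup_le htrunc
  · intro i j hij x
    exact ENNReal.rpow_le_rpow (min_le_min_left _ (by exact_mod_cast hij)) hp0.le

theorem HolderBound.renyiDiv_le {p q κ : ℝ} (hpq : p.HolderConjugate q)
    {μ ν : Measure X} [IsFiniteMeasure μ] [IsFiniteMeasure ν]
    (h : HolderBound q (ENNReal.ofReal (Real.exp ((p - 1) * κ))) μ ν) :
    renyiDiv p μ ν ≤ ((p * κ : ℝ) : EReal) := by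
  rw [renyiDiv, if_pos (h.absolutelyContinuous hpq.symm.pos)]
  have hp : 0 < p - 1 := by linarith [hpq.lt]
  have h1 := ENNReal.log_monotone (h.lintegral_rnDeriv_rpow_le hpq)
  rw [ENNReal.ofReal_rpow_of_pos (Real.exp_pos _), ← Real.exp_mul,
    ENNReal.log_ofReal_of_pos (Real.exp_pos _), Real.log_exp] at h1
  refine (mul_le_mul_of_nonneg_left h1 (by exact_mod_cast (inv_pos.2 hp).le)).trans_eq ?_
  rw [← EReal.coe_mul]
  congr 1
  field_simp

end HolderBound

/-! ### Composition along the iterates -/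

section Iterates

variable {n k b : ℕ} {lam C : ℝ} {h : EuclideanSpace ℝ (Fin n) → EReal}
  {f f' : Fin k → EuclideanSpace ℝ (Fin n) → ℝ}

/-- No regularity of `g` is needed: `fderiv` is zero wherever `g` is not differentiable, and is
measurable everywhere. -/
theorem measurable_gradient (g : EuclideanSpace ℝ (Fin n) → ℝ) : Measurable (gradient g) :=
  (InnerProductSpace.toDual ℝ (EuclideanSpace ℝ (Fin n))).symm.continuous.measurable.comp
    (measurable_fderiv ℝ g)

theorem measurable_batchGrad (hC : 0 ≤ C) (t : ℕ) : Measurable (batchGrad C b f t) :=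
  (Finset.measurable_sum _ fun i _ =>
    (measurable_clip hC).comp (measurable_gradient (f i))).const_smul (1 / (b : ℝ))

theorem measurable_prox_const_mul (hlam : 0 < lam) (hh : IsClosedProperConvex h) :
    Measurable (prox fun x => (lam : EReal) * h x) :=
  (hh.const_mul hlam).lipschitzWith_prox.continuous.measurable

theorem measurable_iterate (hlam : 0 < lam) (hC : 0 ≤ C) (hh : IsClosedProperConvex h)
    (x₀ : EuclideanSpace ℝ (Fin n)) {Ω : Type*} [MeasurableSpace Ω]
    {N : ℕ → Ω → EuclideanSpace ℝ (Fin n)} (hN : ∀ t, Measurable (N t)) (t : ℕ) :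
    Measurable fun ω => iterate lam C b h f x₀ (fun t => N t ω) t := by
  induction t with
  | zero => exact measurable_const
  | succ t ih =>
    exact (measurable_prox_const_mul hlam hh).comp
      ((ih.sub (((measurable_batchGrad hC (t + 1)).comp ih).const_smul lam)).add (hN (t + 1)))

theorem iterate_congr {x₀ : EuclideanSpace ℝ (Fin n)} {z z' : ℕ → EuclideanSpace ℝ (Fin n)}
    {t : ℕ} (hz : ∀ s ≤ t, z s = z' s) :
    iterate lam C b h f x₀ z t = iterate lam C b h f x₀ z' t := by
  induction t with
  | zero => rfl
  | succ t ih =>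
    simp only [iterate]
    rw [ih fun s hs => hz s (hs.trans t.le_succ), hz (t + 1) le_rfl]

theorem indepFun_iterate (hlam : 0 < lam) (hC : 0 ≤ C) (hh : IsClosedProperConvex h)
    (x₀ : EuclideanSpace ℝ (Fin n)) {Ω : Type*} [MeasurableSpace Ω] {P : Measure Ω}
    {N : ℕ → Ω → EuclideanSpace ℝ (Fin n)} (hN : ∀ t, Measurable (N t)) (hNind : iIndepFun N P)
    (t : ℕ) :
    IndepFun (fun ω => iterate lam C b h f x₀ (fun t => N t ω) t) (N (t + 1)) P := by
  have hind := hNind.indepFun_finset (Finset.range (t + 1)) {t + 1} (by simp) hN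
  -- The iterate at time `t` uses only the noise up to `t`, so padding with zeros exhibits it as a
  -- function of those finitely many vectors.
  let extend : ℕ → (Finset.range (t + 1) → EuclideanSpace ℝ (Fin n)) →
      EuclideanSpace ℝ (Fin n) :=
    fun s z => if hs : s ∈ Finset.range (t + 1) then z ⟨s, hs⟩ else 0
  have hext : ∀ s, Measurable (extend s) := fun s => by
    by_cases hs : s ∈ Finset.range (t + 1)
    · simpa only [extend, dif_pos hs] using measurable_pi_apply _
    · simpa only [extend, dif_neg hs] using measurable_const
  have hcomp := hind.comp (measurable_iterate (b := b) (f := f) hlam hC hh x₀ hext t)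
    (measurable_pi_apply (⟨t + 1, by simp⟩ : ({t + 1} : Finset ℕ)))
  refine hcomp.congr (Filter.EventuallyEq.of_eq (funext fun ω => ?_)) Filter.EventuallyEq.rfl
  refine iterate_congr fun s hs => ?_
  simp only [extend, dif_pos (Finset.mem_range_succ_iff.2 hs)]

/-- Markov property: the fresh noise is independent of the current iterate, so their joint law is a
product. -/
theorem lintegral_map_iterate_succ (hlam : 0 < lam) (hC : 0 ≤ C) (hh : IsClosedProperConvex h)
    (x₀ : EuclideanSpace ℝ (Fin n)) {Ω : Type*} [MeasurableSpace Ω] {P : Measure Ω}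
    [IsProbabilityMeasure P] {N : ℕ → Ω → EuclideanSpace ℝ (Fin n)} (hN : ∀ t, Measurable (N t))
    (hNind : iIndepFun N P) {γ : Measure (EuclideanSpace ℝ (Fin n))} (hNlaw : ∀ t, P.map (N t) = γ)
    (t : ℕ) {φ : EuclideanSpace ℝ (Fin n) → ℝ≥0∞} (hφ : Measurable φ) :
    ∫⁻ y, φ y ∂P.map (fun ω => iterate lam C b h f x₀ (fun t => N t ω) (t + 1)) =
      ∫⁻ x, ∫⁻ z, φ (prox (fun x => (lam : EReal) * h x)
        (x - lam • batchGrad C b f (t + 1) x + z)) ∂γ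
        ∂P.map (fun ω => iterate lam C b h f x₀ (fun t => N t ω) t) := by
  have hX := measurable_iterate (b := b) (f := f) hlam hC hh x₀ hN t
  have hγ : IsProbabilityMeasure γ := by
    rw [← hNlaw 0]; exact Measure.isProbabilityMeasure_map (hN 0).aemeasurable
  have hF : Measurable fun p : EuclideanSpace ℝ (Fin n) × EuclideanSpace ℝ (Fin n) =>
      φ (prox (fun x => (lam : EReal) * h x) (p.1 - lam • batchGrad C b f (t + 1) p.1 + p.2)) :=
    hφ.comp ((measurable_prox_const_mul hlam hh).comp ((measurable_fst.sub
      (((measurable_batchGrad hC (t + 1)).comp measurable_fst).const_smul lam)).add measurable_snd))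
  have hprod := (indepFun_iff_map_prod_eq_prod_map_map hX.aemeasurable (hN (t + 1)).aemeasurable).1
    (indepFun_iterate (b := b) (f := f) hlam hC hh x₀ hN hNind t)
  have hμ := Measure.isProbabilityMeasure_map (μ := P) hX.aemeasurable
  rw [lintegral_map hφ (measurable_iterate hlam hC hh x₀ hN (t + 1)),
    ← lintegral_prod _ hF.aemeasurable, ← hNlaw (t + 1), ← hprod,
    lintegral_map hF (hX.prodMk (hN (t + 1)))]
  rfl

theorem norm_batchGrad_sub_le (hC : 0 ≤ C) {i₀ : Fin k} (hff' : ∀ i, i ≠ i₀ → f' i = f i)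
    (t : ℕ) (x : EuclideanSpace ℝ (Fin n)) :
    ‖batchGrad C b f t x - batchGrad C b f' t x‖ ≤
      if i₀ ∈ batch k b t then 2 * C / b else 0 := by
  rw [batchGrad, batchGrad, ← smul_sub, ← Finset.sum_sub_distrib]
  have hzero : ∀ i, i ≠ i₀ → clip C (gradient (f i) x) - clip C (gradient (f' i) x) = 0 :=
    fun i hi => by rw [hff' i hi, sub_self]
  split_ifs with hi
  · rw [Finset.sum_eq_single_of_mem i₀ hi fun i _ => hzero i, norm_smul, Real.norm_eq_abs,
      abs_of_nonneg (by positivity), one_div_mul_eq_div]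
    gcongr
    have h1 := norm_clip_le hC (gradient (f i₀) x)
    have h2 := norm_clip_le hC (gradient (f' i₀) x)
    linarith [norm_sub_le (clip C (gradient (f i₀) x)) (clip C (gradient (f' i₀) x))]
  · rw [Finset.sum_eq_zero fun i hi' => hzero i (ne_of_mem_of_not_mem hi' hi), smul_zero, norm_zero]

/-- Adaptive composition of the Gaussian mechanisms applied in the individual steps. -/
theorem holderBound_iterate (hlam : 0 < lam) (hC : 0 ≤ C) {σ : ℝ} (hσ : 0 < σ)
    (hh : IsClosedProperConvex h) {i₀ : Fin k} (hff' : ∀ i, i ≠ i₀ → f' i = f i)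
    (x₀ : EuclideanSpace ℝ (Fin n)) {Ω : Type*} [MeasurableSpace Ω] {P : Measure Ω}
    [IsProbabilityMeasure P] {N : ℕ → Ω → EuclideanSpace ℝ (Fin n)} (hN : ∀ t, Measurable (N t))
    (hNind : iIndepFun N P) (hNlaw : ∀ t, P.map (N t) = isoGaussian n σ)
    {p q : ℝ} (hpq : p.HolderConjugate q) (t : ℕ) :
    HolderBound q (ENNReal.ofReal (Real.exp ((p - 1) *
        (((Finset.range t).filter fun s => i₀ ∈ batch k b (s + 1)).card *
          ((lam * (2 * C / b)) ^ 2 / (2 * σ ^ 2))))))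
      (P.map fun ω => iterate lam C b h f x₀ (fun t => N t ω) t)
      (P.map fun ω => iterate lam C b h f' x₀ (fun t => N t ω) t) := by
  have hq : 0 < q := hpq.symm.pos
  induction t with
  | zero =>
    intro φ hφ
    simp only [iterate, Measure.map_const, measure_univ, one_smul, lintegral_dirac' _ hφ,
      lintegral_dirac' _ (hφ.pow_const q)]
    rw [← ENNReal.rpow_mul, mul_one_div_cancel hq.ne']
    simp
  | succ t ih =>
    intro φ hφ
    rw [lintegral_map_iterate_succ hlam hC hh x₀ hN hNind hNlaw t hφ,
      lintegral_map_iterate_succ hlam hC hh x₀ hN hNind hNlaw t (hφ.pow_const q)]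
    set r : ℝ := lam * if i₀ ∈ batch k b (t + 1) then 2 * C / b else 0 with hr
    have hprox := measurable_prox_const_mul (h := h) hlam hh
    have hγ : IsProbabilityMeasure (isoGaussian n σ) := by
      rw [← hNlaw 0]; exact Measure.isProbabilityMeasure_map (hN 0).aemeasurable
    set F : EuclideanSpace ℝ (Fin n) → ℝ≥0∞ := fun x => ∫⁻ z, φ (prox (fun x => (lam : EReal) * h x)
      (x - lam • batchGrad C b f' (t + 1) x + z)) ^ q ∂isoGaussian n σ with hFdef
    have hF : Measurable F := by
      refine Measurable.lintegral_prod_right' (f := fun p : EuclideanSpace ℝ (Fin n) ×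
        EuclideanSpace ℝ (Fin n) => φ (prox (fun x => (lam : EReal) * h x)
          (p.1 - lam • batchGrad C b f' (t + 1) p.1 + p.2)) ^ q) ?_
      exact (hφ.comp (hprox.comp ((measurable_fst.sub (((measurable_batchGrad hC (t + 1)).comp
        measurable_fst).const_smul lam)).add measurable_snd))).pow_const q
    have hstep : ∀ x, ∫⁻ z, φ (prox (fun x => (lam : EReal) * h x)
        (x - lam • batchGrad C b f (t + 1) x + z)) ∂isoGaussian n σ ≤
        ENNReal.ofReal (Real.exp ((p - 1) * r ^ 2 / (2 * σ ^ 2))) * F x ^ (1 / q) := fun x => by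
      -- Post-processing is free: the proximal map is absorbed into the test function.
      refine lintegral_isoGaussian_shift_le hσ hpq _ (x - lam • batchGrad C b f' (t + 1) x) ?_
        (hφ.comp hprox)
      rw [sub_sub_sub_cancel_left, ← smul_sub, norm_smul, Real.norm_of_nonneg hlam.le,
        norm_sub_rev]
      exact mul_le_mul_of_nonneg_left (norm_batchGrad_sub_le hC hff' _ _) hlam.le
    refine (lintegral_mono hstep).trans ?_
    rw [lintegral_const_mul _ (hF.pow_const _)]
    -- The induction hypothesis is tested on `F ^ (1 / q)`, whose `q`-th power is `F` again; the
    -- constants multiply, so the exponents add.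
    refine (mul_le_mul_right (ih _ (hF.pow_const _)) _).trans_eq ?_
    simp_rw [← ENNReal.rpow_mul, one_div_mul_cancel hq.ne', ENNReal.rpow_one]
    rw [← mul_assoc, ← ENNReal.ofReal_mul (Real.exp_pos _).le, ← Real.exp_add]
    congr 3
    rw [Finset.range_add_one, Finset.filter_insert, hr]
    split_ifs with hi
    · rw [Finset.card_insert_of_notMem (by simp)]
      push_cast
      ring
    · simp

/-- Each index belongs to the batch of one step per pass. -/
theorem card_filter_mem_batch_le (hb : b ∣ k) (i₀ : Fin k) (T : ℕ) :
    ((Finset.range T).filter fun s => i₀ ∈ batch k b (s + 1)).card ≤ T / (k / b) + 1 := by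
  obtain ⟨l, rfl⟩ := hb
  have hbl : 0 < b * l := i₀.pos
  have hb0 : 0 < b := Nat.pos_of_mul_pos_right hbl
  have hl0 : 0 < l := Nat.pos_of_mul_pos_left hbl
  rw [Nat.mul_div_cancel_left l hb0]
  have hsub : ((Finset.range T).filter fun s => i₀ ∈ batch (b * l) b (s + 1)) ⊆
      (Finset.range T).filter fun s => s ≡ (i₀ : ℕ) / b [MOD l] := by
    intro s hs
    rw [Finset.mem_filter] at hs ⊢
    refine ⟨hs.1, ?_⟩
    have h1 := hs.2
    simp only [batch, Finset.mem_filter, Finset.mem_univ, true_and, Finset.mem_Icc,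
      Nat.add_sub_cancel, Nat.mul_mod_mul_left] at h1
    -- Step `s + 1` uses the block of `b` indices starting at offset `b * (s % l)`, so membership
    -- fixes the residue of `s` modulo `l`.
    have h2 : (i₀ : ℕ) / b = s % l := by
      rw [Nat.div_eq_iff hb0, mul_comm (s % l)]
      omega
    rw [h2]
    exact (Nat.mod_modEq s l).symm
  refine (Finset.card_le_card hsub).trans ?_
  rw [← Nat.count_eq_card_filter_range, Nat.count_modEq_card _ hl0]
  split_ifs <;> omega

theorem theta_nonneg {L : ℝ} (hL : 0 ≤ L) (s : ℕ) : 0 ≤ theta L s := by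
  unfold theta
  split_ifs
  · exact le_rfl
  · positivity

end Iterates

end DPSGD

/-! ### The pass-independent Rényi bound -/

theorem corollaryC3 {n k b T : ℕ} {lam C σ m M α : ℝ}
    -- parameters: `b` divides `k`, so that one pass takes `k / b` steps
    (hb : b ∣ k) (hT : k / b ≤ T)
    (hlam : 0 < lam) (hC : 0 ≤ C) (hσ : 0 < σ) (hα : 1 < α) (hm : 0 ≤ m) (hM : 0 ≤ M)
    -- the regularizer and the two neighboring families of losses, which differ only at `i₀`
    (h : EuclideanSpace ℝ (Fin n) → EReal) (hh : DPSGD.IsClosedProperConvex h)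
    (f f' : Fin k → EuclideanSpace ℝ (Fin n) → ℝ)
    (i₀ : Fin k) (hff' : ∀ i, i ≠ i₀ → f' i = f i)
    (hf : DPSGD.CurvatureBounds m M h f) (hf' : DPSGD.CurvatureBounds m M h f')
    -- the common starting point and the i.i.d. Gaussian noise
    (x₀ : EuclideanSpace ℝ (Fin n)) (hx₀ : x₀ ∈ DPSGD.dom h)
    {Ω : Type*} [MeasurableSpace Ω] (P : Measure Ω) [IsProbabilityMeasure P]
    (N : ℕ → Ω → EuclideanSpace ℝ (Fin n)) (hN : ∀ t, Measurable (N t))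
    (hNind : iIndepFun N P) (hNlaw : ∀ t, P.map (N t) = DPSGD.isoGaussian n σ)
    -- the stepsize condition, with `E = ⌊T / (k / b)⌋`
    (hlamE : lam ≤ 1 / Real.sqrt ((T / (k / b) : ℕ) : ℝ))
    (hlammM : 0 < m + M → lam ≤ 1 / (2 * (m + M))) :
    Measurable (fun ω => DPSGD.iterate lam C b h f x₀ (fun t => N t ω) T) ∧
    Measurable (fun ω => DPSGD.iterate lam C b h f' x₀ (fun t => N t ω) T) ∧
    DPSGD.renyiDiv α
        (P.map fun ω => DPSGD.iterate lam C b h f x₀ (fun t => N t ω) T)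
        (P.map fun ω => DPSGD.iterate lam C b h f' x₀ (fun t => N t ω) T) ≤
      ((4 * α * (C / (b * σ)) ^ 2 * (1 + DPSGD.theta (DPSGD.lipConst lam m M) (k / b)) : ℝ) :
        EReal) := by
  have hX := DPSGD.measurable_iterate (b := b) (f := f) hlam hC hh x₀ hN T
  have hX' := DPSGD.measurable_iterate (b := b) (f := f') hlam hC hh x₀ hN T
  refine ⟨hX, hX', ?_⟩
  have hP := Measure.isProbabilityMeasure_map (μ := P) hX.aemeasurable
  have hP' := Measure.isProbabilityMeasure_map (μ := P) hX'.aemeasurable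
  have hbound := DPSGD.holderBound_iterate (b := b) hlam hC hσ hh hff' x₀ hN hNind hNlaw
    (Real.HolderConjugate.conjExponent hα) T
  refine (hbound.renyiDiv_le (Real.HolderConjugate.conjExponent hα)).trans ?_
  rw [EReal.coe_le_coe_iff]
  have hk : 0 < k := i₀.pos
  have hb0 : 0 < b := Nat.pos_of_dvd_of_pos hb hk
  have hl0 : 0 < k / b := Nat.div_pos (Nat.le_of_dvd hk hb) hb0
  have hcard := DPSGD.card_filter_mem_batch_le hb i₀ T
  set K := ((Finset.range T).filter fun s => i₀ ∈ DPSGD.batch k b (s + 1)).card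
  set E := T / (k / b) with hE
  have hE1 : 1 ≤ E := Nat.div_pos hT hl0
  have hE0 : (0 : ℝ) < E := by exact_mod_cast hE1
  have hlam2 : lam ^ 2 * E ≤ 1 := by
    have hmul := (le_div_iff₀ (Real.sqrt_pos.2 hE0)).1 hlamE
    have hsq := pow_le_pow_left₀ (by positivity) hmul 2
    rwa [mul_pow, Real.sq_sqrt hE0.le, one_pow] at hsq
  -- The possible visit in an incomplete last pass is absorbed using `1 ≤ E`, which comes from `k /
  -- b ≤ T`.
  have hKE : (K : ℝ) ≤ 2 * E := by exact_mod_cast (by omega : K ≤ 2 * E)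
  have hlamK : lam ^ 2 * K ≤ 2 := by nlinarith [sq_nonneg lam]
  have hθ := DPSGD.theta_nonneg (Real.sqrt_nonneg _ : 0 ≤ DPSGD.lipConst lam m M) (k / b)
  have hbR : (0 : ℝ) < b := by exact_mod_cast hb0
  have hα0 : 0 < α := by linarith
  calc α * (K * ((lam * (2 * C / b)) ^ 2 / (2 * σ ^ 2)))
      = 2 * α * (C / (b * σ)) ^ 2 * (lam ^ 2 * K) := by field_simp
    _ ≤ 2 * α * (C / (b * σ)) ^ 2 * 2 := by gcongr
    _ = 4 * α * (C / (b * σ)) ^ 2 * 1 := by ring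
    _ ≤ 4 * α * (C / (b * σ)) ^ 2 * (1 + DPSGD.theta (DPSGD.lipConst lam m M) (k / b)) := by
        gcongr
        exact le_add_of_nonneg_right hθ
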